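/- **Setting.** Let $G=(V,E)$ be a finite connected simple graph with at least two vertices, $\gamma>0$, $N\ge 0$, and let $\tilde d_G(u,w)$ be the number of edges of a shortest path from $u$ to $w$. Put the vertices of $G$ as affinely independent points and let $$G^c=\{u+t(w-u)\;:\;u,w\in V,\ u\sim w,\ t\in[-\tfrac12,\tfrac12]\},$$ where every edge is given length $\sqrt\gamma$; the range of layer $u$ is the part $\{u+t(w-u): w\sim u,\ |t|\le\frac12\}$. Let $[G^c]_0$ be the set of injective continuous paths $p:[a,b]\to G^c$ parametrized by arc length, and let $\mathcal M$ be $\mathbb R^N\times G^c$ with the charts $\mathbb R^N\times p$, $p\in[G^c]_0$, with coordinates $(x,z)\in\mathbb R^N\times[a,b]$. A path $p$ contains layer $u$ if $p(c)=u$ for some $c$ with $[c-\frac{\sqrt\gamma}2,c+\frac{\sqrt\gamma}2]\subseteq[a,b]$. A *Gaussian cylinder* on layer $u$ is a distribution on $\mathcal M$ which, in some chart $\mathbb R^N\times p$ whose path contains layer $u$, is the product of a Gaussian on $\mathbb R^N$ and the uniform distribution on $[c-\frac{\sqrt\gamma}2,c+\frac{\sqrt\gamma}2]$. Its projection to layer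 $u$ is the distribution on $\mathbb R^N$ obtained by integrating out the last variable over the range of layer $u$. For distributions $\mu_0,\mu_1$ on $\mathcal M$ let $$C_{\mathcal M}(\mu_0,\mu_1)=\inf_{p}\ \inf_{\pi}\int \|x-y\|^2+|z_1-z_2|^2\ \pi(dx\,dz_1,dy\,dz_2),$$ where $p$ runs over $[G^c]_0$ and $\pi$ over the couplings of $\mu_0$ and $\mu_1$ carried by the chart $\mathbb R^N\times p$, in the coordinates of that chart ($\inf\emptyset=\infty$). **Theorem.** Let $u,w\in V$ and let $\nu_0,\nu_1$ be Gaussian distributions on $\mathbb R^N$. The optimal transport cost on $\mathcal M$ between Gaussian cylinders lifting $\nu_0$ on layer $u$ and $\nu_1$ on layer $w$, $$d_{\mathcal M}=\inf\{C_{\mathcal M}(\mu_0,\mu_1)\;:\;\mu_0,\mu_1\text{ Gaussian cylinders on layers }u,w\text{ with projections }\nu_0,\nu_1\},$$ is $$d_{\mathcal M}=\mathcal W_2(\nu_0,\nu_1)^2+\gamma\,\tilde d_G(u,w)^2,$$ and there are two such Gaussian cylinders $\mu_0,\mu_1$ with $C_{\mathcal M}(\mu_0,\mu_1)$ equal to this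 value. -/

import Mathlib

open MeasureTheory ProbabilityTheory Set
open scoped ENNReal NNReal

noncomputable section

namespace VectorGMM

/-- `π` is a coupling of `μ` and `ν`. -/
def IsCoupling {X Y : Type*} [MeasurableSpace X] [MeasurableSpace Y]
    (π : Measure (X × Y)) (μ : Measure X) (ν : Measure Y) : Prop :=
  π.map Prod.fst = μ ∧ π.map Prod.snd = ν

/-- The Wasserstein-2 distance of two distributions on `ℝ^N`. -/
def W2 {N : ℕ} (μ ν : Measure (EuclideanSpace ℝ (Fin N))) : ℝ≥0∞ :=
  (⨅ (π : Measure (EuclideanSpace ℝ (Fin N) × EuclideanSpace ℝ (Fin N)))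
    (_ : IsCoupling π μ ν), ∫⁻ q, ENNReal.ofReal (‖q.1 - q.2‖ ^ 2) ∂π) ^ (1 / 2 : ℝ)

section Graph

variable {V : Type*} [Fintype V] [DecidableEq V]

/-- The abstract vertex `u`, as a point of `ℝ^V`. The vertices are affinely independent and, in the
sup norm of `V → ℝ`, any two distinct ones have distance `√γ`, the thickness of a layer. -/
def vertexPoint (γ : ℝ) (u : V) : V → ℝ := Pi.single u (Real.sqrt γ)

/-- The range of layer `u`: all points `u + t (w - u)` with `w ∼ u` and `t ∈ [-1/2, 1/2]`. -/
def layerRange (G : SimpleGraph V) (γ : ℝ) (u : V) : Set (V → ℝ) :=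
  {z | ∃ w, G.Adj u w ∧ ∃ t ∈ Icc (-(1 / 2) : ℝ) (1 / 2),
    z = vertexPoint γ u + t • (vertexPoint γ w - vertexPoint γ u)}

/-- The continuous graph `{u + t (w - u) | u ∼ w, t ∈ [-1/2, 1/2]}`. -/
def contGraph (G : SimpleGraph V) (γ : ℝ) : Set (V → ℝ) :=
  ⋃ u, layerRange G γ u

/-- An acyclic path on the continuous graph, parametrized by arc length on `[left, right]`.
Being injective on `[left, right]`, it meets no vertex twice and does not turn back. (The values of
the function outside `[left, right]` play no role.) -/
structure AcyclicPath (G : SimpleGraph V) (γ : ℝ) where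
  left : ℝ
  right : ℝ
  left_lt_right : left < right
  toFun : ℝ → contGraph G γ
  continuous_toFun : Continuous toFun
  injOn : InjOn toFun (Icc left right)
  unitSpeed : HasUnitSpeedOn toFun (Icc left right)

/-- The path `p` passes through the vertex `u` at parameter `c` and contains a whole layer there:
half an edge length on both sides of `u`. -/
def AcyclicPath.ContainsLayerAt {G : SimpleGraph V} {γ : ℝ} (p : AcyclicPath G γ)
    (u : V) (c : ℝ) : Prop :=
  (p.toFun c : V → ℝ) = vertexPoint γ u ∧
    Icc (c - Real.sqrt γ / 2) (c + Real.sqrt γ / 2) ⊆ Icc p.left p.right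

/-- The space `ℝ^N × G^c` underlying the manifold. -/
abbrev Manifold (N : ℕ) (G : SimpleGraph V) (γ : ℝ) : Type _ :=
  EuclideanSpace ℝ (Fin N) × contGraph G γ

/-- The chart `ℝ^N × p` in coordinates: the inverse of the coordinate map. Its coordinate domain is
`ℝ^N × [left, right]`. -/
def AcyclicPath.chart {G : SimpleGraph V} {γ : ℝ} (N : ℕ) (p : AcyclicPath G γ) :
    EuclideanSpace ℝ (Fin N) × ℝ → Manifold N G γ :=
  fun q => (q.1, p.toFun q.2)

/-- The coordinate domain of the chart `ℝ^N × p`. -/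
def AcyclicPath.chartDomain {G : SimpleGraph V} {γ : ℝ} (N : ℕ) (p : AcyclicPath G γ) :
    Set (EuclideanSpace ℝ (Fin N) × ℝ) :=
  univ ×ˢ Icc p.left p.right

/-- The projection of a distribution on the manifold to layer `u`: the last variable is integrated
out over the range of layer `u`. -/
def layerProjection {N : ℕ} {G : SimpleGraph V} {γ : ℝ} (u : V)
    (μ : Measure (Manifold N G γ)) : Measure (EuclideanSpace ℝ (Fin N)) :=
  (μ.restrict {q | (q.2 : V → ℝ) ∈ layerRange G γ u}).map Prod.fst

/-- `μ` is a Gaussian cylinder on layer `u`: the image, under some chart containing the layer, of the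
product of a Gaussian and the uniform distribution on the range of the layer in that chart. -/
def IsGaussianCylinder {N : ℕ} {G : SimpleGraph V} {γ : ℝ} (u : V)
    (μ : Measure (Manifold N G γ)) : Prop :=
  ∃ (ν : Measure (EuclideanSpace ℝ (Fin N))) (p : AcyclicPath G γ) (c : ℝ),
    IsGaussian ν ∧ p.ContainsLayerAt u c ∧
    μ = (ν.prod (volume[|Icc (c - Real.sqrt γ / 2) (c + Real.sqrt γ / 2)])).map (p.chart N)

/-- `μ` is a Gaussian cylinder on layer `u` that projects to `ν`. -/
def IsCylinderLift {N : ℕ} {G : SimpleGraph V} {γ : ℝ} (u : V)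
    (ν : Measure (EuclideanSpace ℝ (Fin N))) (μ : Measure (Manifold N G γ)) : Prop :=
  IsGaussianCylinder u μ ∧ layerProjection u μ = ν

/-- `π` is a transport plan from `μ₀` to `μ₁` inside the chart `ℝ^N × p`, written in the coordinates
of the chart. There is none unless the chart carries both distributions. -/
def IsChartCoupling {N : ℕ} {G : SimpleGraph V} {γ : ℝ} (p : AcyclicPath G γ)
    (μ₀ μ₁ : Measure (Manifold N G γ))
    (π : Measure ((EuclideanSpace ℝ (Fin N) × ℝ) × (EuclideanSpace ℝ (Fin N) × ℝ))) : Prop :=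
  π (p.chartDomain N ×ˢ p.chartDomain N)ᶜ = 0 ∧
  IsCoupling (π.map (Prod.map (p.chart N) (p.chart N))) μ₀ μ₁

/-- The optimal quadratic transport cost between two distributions on the manifold: the infimum, over
all charts and all transport plans within the chart, of the squared distance in the chart. -/
def manifoldCost {N : ℕ} {G : SimpleGraph V} {γ : ℝ} (μ₀ μ₁ : Measure (Manifold N G γ)) : ℝ≥0∞ :=
  ⨅ (p : AcyclicPath G γ)
    (π : Measure ((EuclideanSpace ℝ (Fin N) × ℝ) × (EuclideanSpace ℝ (Fin N) × ℝ)))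
    (_ : IsChartCoupling p μ₀ μ₁ π),
    ∫⁻ q, ENNReal.ofReal (‖q.1.1 - q.2.1‖ ^ 2 + |q.1.2 - q.2.2| ^ 2) ∂π

/-- The transport cost on the manifold between the Gaussians `ν₀` on layer `u` and `ν₁` on layer `w`:
the least cost between Gaussian cylinders projecting to them. -/
def cylinderCost {N : ℕ} (G : SimpleGraph V) (γ : ℝ) (u w : V)
    (ν₀ ν₁ : Measure (EuclideanSpace ℝ (Fin N))) : ℝ≥0∞ :=
  ⨅ (μ₀ : Measure (Manifold N G γ)) (_ : IsCylinderLift u ν₀ μ₀)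
    (μ₁ : Measure (Manifold N G γ)) (_ : IsCylinderLift w ν₁ μ₁), manifoldCost μ₀ μ₁

end Graph

end VectorGMM

end

/-!
*Lower bound.* A chart that carries a cylinder on layer `u` contains the arc of this layer, and
since arc length parametrizations are unique up to isometries of the line, in this chart the last
variable of the cylinder is uniform on an interval centred at a parameter `c₀` where the path is at
`u`. Likewise for `w` and `c₁`. The linear function which is the graph distance to `u` at each
vertex has slope at most one along every edge, hence along the path, so `|c₀ - c₁| ≥ √γ * d(u, w)`.
A coupling in the chart costs at least the squared Wasserstein distance in the space variable and,
by Jensen's inequality, `(c₀ - c₁)²` in the last one.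

*Upper bound.* A shortest path, prolonged by half an edge at both ends, is injective because the
same linear function grows along it at unit rate. In its chart, take the product of an almost
optimal coupling in the space variable and a translation in the last one.
-/

open Filter Topology

namespace VectorGMM

section UnitSpeed

variable {X : Type*} {f : ℝ → X} {s t : Set ℝ} {l : ℝ≥0}

theorem hasConstantSpeedOnWith_mono [PseudoEMetricSpace X] (hf : HasConstantSpeedOnWith f t l)
    (hs : s.OrdConnected) (hst : s ⊆ t) : HasConstantSpeedOnWith f s l := by
  refine hasConstantSpeedOnWith_iff_ordered.2 fun x hx y hy _ => ?_
  have h := hs.out hx hy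
  rw [← hf (hst hx) (hst hy), inter_eq_right.2 h, inter_eq_right.2 (h.trans hst)]

theorem lipschitzOnWith_of_hasConstantSpeedOnWith [PseudoEMetricSpace X]
    (hf : HasConstantSpeedOnWith f s l) : LipschitzOnWith l f s := by
  intro x hx y hy
  wlog hxy : x ≤ y generalizing x y
  · rw [edist_comm (f x), edist_comm x]
    exact this hy hx (le_of_not_ge hxy)
  calc edist (f x) (f y) ≤ eVariationOn f (s ∩ Icc x y) :=
        eVariationOn.edist_le f ⟨hx, left_mem_Icc.2 hxy⟩ ⟨hy, right_mem_Icc.2 hxy⟩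
    _ = l * edist x y := by
        rw [hf hx hy, edist_comm, edist_dist, Real.dist_eq, abs_of_nonneg (sub_nonneg.2 hxy),
          ENNReal.ofReal_mul l.coe_nonneg, ENNReal.ofReal_coe_nnreal]

theorem dist_le_of_hasUnitSpeedOn [PseudoMetricSpace X] (hf : HasUnitSpeedOn f s) {x y : ℝ}
    (hx : x ∈ s) (hy : y ∈ s) : dist (f x) (f y) ≤ |x - y| := by
  simpa [Real.dist_eq] using
    (lipschitzOnWith_of_hasConstantSpeedOnWith hf).dist_le_mul x hx y hy

theorem hasConstantSpeedOnWith_of_edist_eq [PseudoEMetricSpace X] (hs : s.OrdConnected)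
    (hf : ∀ x ∈ s, ∀ y ∈ s, edist (f x) (f y) = l * edist x y) :
    HasConstantSpeedOnWith f s l := by
  refine hasConstantSpeedOnWith_iff_ordered.2 fun x hx y hy hxy => ?_
  have hsub : Icc x y ⊆ s := hs.out hx hy
  rw [inter_eq_right.2 hsub, ENNReal.ofReal_mul l.coe_nonneg, ENNReal.ofReal_coe_nnreal]
  calc eVariationOn f (Icc x y) = l * eVariationOn id (Icc x y) := by
        simp only [eVariationOn, ENNReal.mul_iSup, Finset.mul_sum]
        refine iSup_congr fun q => Finset.sum_congr rfl fun i _ => ?_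
        exact hf _ (hsub (q.2.2.2 _)) _ (hsub (q.2.2.2 _))
    _ = l * ENNReal.ofReal (y - x) := by
        have h := (monotone_id.monotoneOn (Icc x y)).eVariationOn_eq
          (left_mem_Icc.2 hxy) (right_mem_Icc.2 hxy)
        rw [inter_self] at h
        exact congrArg _ h

theorem hasUnitSpeedOn_of_dist_eq [PseudoMetricSpace X] (hs : s.OrdConnected)
    (hf : ∀ x ∈ s, ∀ y ∈ s, dist (f x) (f y) = |x - y|) : HasUnitSpeedOn f s :=
  hasConstantSpeedOnWith_of_edist_eq hs fun x hx y hy => by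
    rw [ENNReal.coe_one, one_mul, edist_dist, edist_dist, hf x hx y hy, Real.dist_eq]

theorem hasUnitSpeedOn_comp_neg [PseudoEMetricSpace X] (hf : HasUnitSpeedOn f s) :
    HasUnitSpeedOn (f ∘ Neg.neg) (Neg.neg ⁻¹' s) := by
  intro x hx y hy
  have himage : Neg.neg '' (Neg.neg ⁻¹' s ∩ Icc x y) = s ∩ Icc (-y) (-x) := by
    rw [image_preimage_inter, image_neg_Icc]
  rw [eVariationOn.comp_eq_of_antitoneOn _ _ (fun _ _ _ _ => neg_le_neg), himage, hf hy hx,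
    neg_sub_neg]

theorem eqOn_comp_add_of_monotoneOn [PseudoEMetricSpace X] {g : ℝ → X} {φ : ℝ → ℝ}
    (hs : IsPreconnected s) (hf : HasUnitSpeedOn f t) (hg : HasUnitSpeedOn g s)
    (hφ : MonotoneOn φ s) (hφc : ContinuousOn φ s) (hφt : MapsTo φ s t) (hfφ : EqOn (f ∘ φ) g s) :
    ∃ k, EqOn φ (· + k) s := by
  obtain rfl | ⟨x, hx⟩ := s.eq_empty_or_nonempty
  · exact ⟨0, eqOn_empty _ _⟩
  have hf' : HasUnitSpeedOn f (φ '' s) :=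
    hasConstantSpeedOnWith_mono hf (hs.image φ hφc).ordConnected hφt.image_subset
  have hg' : HasUnitSpeedOn (f ∘ φ) s := fun y hy z hz => by
    rw [eVariationOn.congr (hfφ.mono inter_subset_left), hg hy hz]
  refine ⟨φ x - x, fun y hy => ?_⟩
  rw [unique_unit_speed hφ hg' hf' hx hy]
  ring

theorem continuousOn_of_continuousOn_comp [TopologicalSpace X] [T2Space X] {φ : ℝ → ℝ}
    (ht : IsCompact t) (hf : ContinuousOn f t) (hfi : InjOn f t) (hφ : MapsTo φ s t)
    (hfφ : ContinuousOn (f ∘ φ) s) : ContinuousOn φ s := by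
  have := isCompact_iff_compactSpace.1 ht
  have hemb : IsClosedEmbedding (t.domRestrict f) :=
    hf.domRestrict.isClosedEmbedding hfi.injective
  have hc : Continuous (hφ.restrict φ s t) :=
    hemb.isInducing.continuous_iff.2 hfφ.domRestrict
  exact continuousOn_iff_continuous_domRestrict.2 (continuous_subtype_val.comp hc)

-- Arc length parametrizations are unique up to orientation and origin. A reflection reduces the
-- orientation reversing case to the orientation preserving one.
theorem exists_isometryEquiv_eqOn_comp [MetricSpace X] {g : ℝ → X} {a b : ℝ} (hab : a ≤ b)
    (ht : IsCompact t) (hfi : InjOn f t) (hf : HasUnitSpeedOn f t) (hgi : InjOn g (Icc a b))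
    (hg : HasUnitSpeedOn g (Icc a b)) (hgf : MapsTo g (Icc a b) (f '' t)) :
    ∃ e : ℝ ≃ᵢ ℝ, MapsTo e (Icc a b) t ∧ EqOn (f ∘ e) g (Icc a b) := by
  have hex : ∀ x ∈ Icc a b, ∃ y ∈ t, f y = g x := hgf
  choose! φ hφt hfφ using hex
  have hφi : InjOn φ (Icc a b) := fun x hx y hy hxy =>
    hgi hx hy (by rw [← hfφ x hx, ← hfφ y hy, hxy])
  have hφc : ContinuousOn φ (Icc a b) := by
    refine continuousOn_of_continuousOn_comp ht
      (lipschitzOnWith_of_hasConstantSpeedOnWith hf).continuousOn hfi hφt ?_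
    exact (lipschitzOnWith_of_hasConstantSpeedOnWith hg).continuousOn.congr hfφ
  suffices ∃ e : ℝ ≃ᵢ ℝ, EqOn φ e (Icc a b) by
    obtain ⟨e, he⟩ := this
    exact ⟨e, MapsTo.congr hφt he, fun x hx => by rw [Function.comp_apply, ← he hx, hfφ x hx]⟩
  rcases hφc.strictMonoOn_of_injOn_Icc' hab hφi with hφ | hφ
  · obtain ⟨k, hk⟩ := eqOn_comp_add_of_monotoneOn isPreconnected_Icc hf hg hφ.monotoneOn hφc hφt hfφ
    exact ⟨.addRight k, hk⟩
  · have hneg : MapsTo Neg.neg (Icc (-b) (-a)) (Icc a b) := fun x hx =>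
      ⟨le_neg_of_le_neg hx.2, neg_le_of_neg_le hx.1⟩
    have hgneg : HasUnitSpeedOn (g ∘ Neg.neg) (Icc (-b) (-a)) := by
      simpa using hasUnitSpeedOn_comp_neg hg
    obtain ⟨k, hk⟩ := eqOn_comp_add_of_monotoneOn (φ := φ ∘ Neg.neg) isPreconnected_Icc hf hgneg
      (hφ.antitoneOn.comp (fun _ _ _ _ => neg_le_neg) hneg)
      (hφc.comp continuousOn_neg hneg) (MapsTo.comp hφt hneg) fun x hx => hfφ _ (hneg hx)
    refine ⟨.subLeft k, fun x hx => ?_⟩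
    have h : φ (- -x) = -x + k := hk ⟨neg_le_neg hx.2, neg_le_neg hx.1⟩
    rw [IsometryEquiv.subLeft_apply, sub_eq_neg_add, ← h, neg_neg]

theorem dist_le_mul_of_eventually_dist_le [PseudoMetricSpace X] {a b C : ℝ} (hab : a ≤ b)
    (hf : ContinuousOn f (Icc a b))
    (hC : ∀ x ∈ Ico a b, ∀ᶠ y in 𝓝[>] x, dist (f y) (f x) ≤ C * (y - x)) :
    dist (f b) (f a) ≤ C * (b - a) := by
  refine image_le_of_liminf_slope_right_le_deriv_boundary (f := fun x => dist (f x) (f a))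
    (B := fun x => C * (x - a)) (B' := fun _ => C) (by fun_prop) (by simp)
    (by fun_prop) (fun x _ => ?_) (fun x hx r hr => ?_) (right_mem_Icc.2 hab)
  · simpa using (((hasDerivAt_id x).sub_const a).const_mul C).hasDerivWithinAt
  · refine Eventually.frequently ?_
    filter_upwards [hC x hx, self_mem_nhdsWithin] with y hy hxy
    rw [mem_Ioi, ← sub_pos] at hxy
    refine lt_of_le_of_lt ?_ hr
    rw [slope_def_field, div_le_iff₀ hxy]
    linarith [dist_triangle (f y) (f x) (f a)]

end UnitSpeed

section UniformLaw

theorem map_cond_of_measurePreserving {α : Type*} [MeasurableSpace α] {μ : Measure α} {e : α → α}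
    (he : MeasurePreserving e μ μ) {t : Set α} (ht : MeasurableSet t) :
    (μ[|e ⁻¹' t]).map e = μ[|t] := by
  rw [ProbabilityTheory.cond, ProbabilityTheory.cond, Measure.map_smul,
    (he.restrict_preimage ht).map_eq, he.measure_preimage ht.nullMeasurableSet]

theorem map_isometryEquiv_cond_Icc (e : ℝ ≃ᵢ ℝ) (c h : ℝ) :
    (volume[|Icc (c - h) (c + h)]).map e = volume[|Icc (e c - h) (e c + h)] := by
  have he : MeasurePreserving e volume volume := by
    simpa only [hausdorffMeasure_real] using e.measurePreserving_hausdorffMeasure 1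
  have hpre : Icc (c - h) (c + h) = e ⁻¹' Icc (e c - h) (e c + h) := by
    rw [← Real.closedBall_eq_Icc, ← Real.closedBall_eq_Icc, e.isometry.preimage_closedBall]
  rw [hpre, map_cond_of_measurePreserving he measurableSet_Icc]

theorem isProbabilityMeasure_cond_Icc {a b : ℝ} (hab : a < b) :
    IsProbabilityMeasure ((volume : Measure ℝ)[|Icc a b]) :=
  cond_isProbabilityMeasure_of_finite (by simp [hab]) (by simp)

theorem integral_cond_Icc {a b : ℝ} (hab : a < b) :
    ∫ x, x ∂((volume : Measure ℝ)[|Icc a b]) = (a + b) / 2 := by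
  have hba : b - a ≠ 0 := (sub_pos.2 hab).ne'
  rw [ProbabilityTheory.cond, integral_smul_measure, integral_Icc_eq_integral_Ioc,
    ← intervalIntegral.integral_of_le hab.le, integral_id, Real.volume_Icc,
    ENNReal.toReal_inv, ENNReal.toReal_ofReal (sub_nonneg.2 hab.le), smul_eq_mul]
  field_simp
  ring

theorem integrable_id_cond_Icc (a b : ℝ) :
    Integrable id ((volume : Measure ℝ)[|Icc a b]) := by
  refine Integrable.of_bound (by fun_prop) (max |a| |b|) ?_
  filter_upwards [ae_cond_mem measurableSet_Icc] with x hx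
  exact abs_le_max_abs_abs hx.1 hx.2

theorem subset_of_ae_cond_mem {α : Type*} [TopologicalSpace α] [MeasurableSpace α]
    [OpensMeasurableSpace α] {μ : Measure α} [μ.IsOpenPosMeasure] {s K : Set α} (hμs : μ s ≠ ∞)
    (hs : s ⊆ closure (interior s)) (hK : IsClosed K) (h : ∀ᵐ x ∂μ[|s], x ∈ K) : s ⊆ K := by
  have hK' : K ∈ ae (μ.restrict s) :=
    (Measure.ae_ennreal_smul_measure_iff (ENNReal.inv_ne_zero.2 hμs)).1 h
  refine hs.trans (closure_minimal ?_ hK)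
  calc interior s = interior s ∩ μ.support := by rw [Measure.support_eq_univ, inter_univ]
    _ ⊆ (μ.restrict s).support := Measure.interior_inter_support
    _ ⊆ K := Measure.support_subset_of_isClosed hK hK'

theorem eq_of_map_eq_of_injOn {α X : Type*} [TopologicalSpace α] [PolishSpace α]
    [MeasurableSpace α] [BorelSpace α] [TopologicalSpace X] [T2Space X] [MeasurableSpace X]
    [BorelSpace X] {f : α → X} {s : Set α} (hs : MeasurableSet s) (hf : Measurable f)
    (hfs : ContinuousOn f s) (hfi : InjOn f s) {m m' : Measure α} (hm : ∀ᵐ x ∂m, x ∈ s)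
    (hm' : ∀ᵐ x ∂m', x ∈ s) (h : m.map f = m'.map f) : m = m' := by
  rcases isEmpty_or_nonempty α
  · rw [m.eq_zero_of_isEmpty, m'.eq_zero_of_isEmpty]
  obtain ⟨g, hg, hgf⟩ := (hfs.measurableEmbedding hs hfi).exists_measurable_extend
    measurable_subtype_coe fun _ => ‹Nonempty α›
  have hinv : ∀ n : Measure α, (∀ᵐ x ∂n, x ∈ s) → n = (n.map f).map g := by
    intro n hn
    have hid : g ∘ f =ᵐ[n] id := by
      filter_upwards [hn] with x hx using congrFun hgf ⟨x, hx⟩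
    rw [Measure.map_map hg hf, Measure.map_congr hid, Measure.map_id]
  rw [hinv m hm, hinv m' hm', h]

-- The image of `m` determines the arc traced by `g`, up to an isometry `e` of the parameter line;
-- then `m` is the image under `e` of a uniform distribution.
theorem exists_eq_cond_Icc_of_map_eq {X : Type*} [MetricSpace X] [MeasurableSpace X]
    [BorelSpace X] {f g : ℝ → X} {t : Set ℝ} {c h : ℝ} (hh : 0 < h) (ht : IsCompact t)
    (hf : Measurable f) (hft : HasUnitSpeedOn f t) (hfi : InjOn f t) (hg : Continuous g)
    (hgs : HasUnitSpeedOn g (Icc (c - h) (c + h))) (hgi : InjOn g (Icc (c - h) (c + h)))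
    {m : Measure ℝ} (hm : ∀ᵐ x ∂m, x ∈ t)
    (hmap : m.map f = (volume[|Icc (c - h) (c + h)]).map g) :
    ∃ c' ∈ t, f c' = g c ∧ m = volume[|Icc (c' - h) (c' + h)] := by
  have hfc : ContinuousOn f t := (lipschitzOnWith_of_hasConstantSpeedOnWith hft).continuousOn
  have hK : IsClosed (f '' t) := (ht.image_of_continuousOn hfc).isClosed
  have hgK : ∀ᵐ x ∂volume[|Icc (c - h) (c + h)], x ∈ g ⁻¹' (f '' t) := by
    refine ae_of_ae_map hg.aemeasurable (p := (· ∈ f '' t)) ?_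
    rw [← hmap]
    refine (ae_map_iff hf.aemeasurable hK.measurableSet).2 ?_
    filter_upwards [hm] with x hx using mem_image_of_mem f hx
  have hgf : MapsTo g (Icc (c - h) (c + h)) (f '' t) :=
    subset_of_ae_cond_mem (by simp)
      (by rw [interior_Icc, closure_Ioo (by linarith)]) (hK.preimage hg) hgK
  obtain ⟨e, het, hfe⟩ := exists_isometryEquiv_eqOn_comp (by linarith) ht hfi hft hgi hgs hgf
  have hc : c ∈ Icc (c - h) (c + h) := ⟨by linarith, by linarith⟩
  refine ⟨e c, het hc, hfe hc, ?_⟩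
  rw [← map_isometryEquiv_cond_Icc]
  have hem : Measurable e := e.continuous.measurable
  refine eq_of_map_eq_of_injOn ht.measurableSet hf hfc hfi hm ?_ ?_
  · refine (ae_map_iff hem.aemeasurable ht.measurableSet).2 ?_
    filter_upwards [ae_cond_mem measurableSet_Icc] with x hx using het hx
  · rw [hmap, Measure.map_map hf hem]
    refine Measure.map_congr ?_
    filter_upwards [ae_cond_mem measurableSet_Icc] with x hx using (hfe hx).symm

end UniformLaw

section Transport

theorem IsCoupling.map {X Y X' Y' : Type*} [MeasurableSpace X] [MeasurableSpace Y]
    [MeasurableSpace X'] [MeasurableSpace Y'] {π : Measure (X × Y)} {μ : Measure X}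
    {ν : Measure Y} (hπ : IsCoupling π μ ν) {f : X → X'} {g : Y → Y'} (hf : Measurable f)
    (hg : Measurable g) : IsCoupling (π.map (Prod.map f g)) (μ.map f) (ν.map g) := by
  obtain ⟨rfl, rfl⟩ := hπ
  constructor
  · rw [Measure.map_map measurable_fst (hf.prodMap hg), Measure.map_map hf measurable_fst]
    rfl
  · rw [Measure.map_map measurable_snd (hf.prodMap hg), Measure.map_map hg measurable_snd]
    rfl

theorem IsCoupling.isProbabilityMeasure {X Y : Type*} [MeasurableSpace X] [MeasurableSpace Y]
    {π : Measure (X × Y)} {μ : Measure X} {ν : Measure Y} [IsProbabilityMeasure μ]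
    (hπ : IsCoupling π μ ν) : IsProbabilityMeasure π := by
  obtain ⟨rfl, -⟩ := hπ
  exact π.isProbabilityMeasure_of_map Prod.fst

theorem IsCoupling.prod_graph {X Y Z Z' : Type*} [MeasurableSpace X] [MeasurableSpace Y]
    [MeasurableSpace Z] [MeasurableSpace Z'] {π : Measure (X × Y)} [SFinite π] {μ : Measure X}
    {ν : Measure Y} (hπ : IsCoupling π μ ν) (m : Measure Z) [SFinite m] {e : Z → Z'}
    (he : Measurable e) :
    IsCoupling ((π.prod m).map fun q => ((q.1.1, q.2), (q.1.2, e q.2)))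
      (μ.prod m) (ν.prod (m.map e)) := by
  obtain ⟨rfl, rfl⟩ := hπ
  constructor
  · calc _ = (π.prod m).map (Prod.map Prod.fst id) := Measure.map_map (by fun_prop) (by fun_prop)
      _ = (π.map Prod.fst).prod m := by
        rw [← Measure.map_prod_map _ _ measurable_fst measurable_id, Measure.map_id]
  · calc _ = (π.prod m).map (Prod.map Prod.snd e) := Measure.map_map (by fun_prop) (by fun_prop)
      _ = (π.map Prod.snd).prod (m.map e) := by
        rw [← Measure.map_prod_map _ _ measurable_snd he]

theorem enorm_integral_sq_le_lintegral {Ω E : Type*} [MeasurableSpace Ω] {μ : Measure Ω}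
    [IsProbabilityMeasure μ] [NormedAddCommGroup E] [NormedSpace ℝ E] (f : Ω → E) :
    ‖∫ x, f x ∂μ‖ₑ ^ 2 ≤ ∫⁻ x, ‖f x‖ₑ ^ 2 ∂μ := by
  by_cases hf : AEStronglyMeasurable f μ
  · calc ‖∫ x, f x ∂μ‖ₑ ^ 2 ≤ eLpNorm f 1 μ ^ 2 := by
          rw [eLpNorm_one_eq_lintegral_enorm]
          gcongr
          exact enorm_integral_le_lintegral_enorm f
      _ ≤ eLpNorm f 2 μ ^ 2 := by
          gcongr
          exact eLpNorm_le_eLpNorm_of_exponent_le one_le_two hf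
      _ = ∫⁻ x, ‖f x‖ₑ ^ 2 ∂μ := by
          simpa using eLpNorm_nnreal_pow_eq_lintegral (f := f) (μ := μ) two_ne_zero
  · simp [integral_non_aestronglyMeasurable hf]

variable {N : ℕ}

theorem W2_sq (μ ν : Measure (EuclideanSpace ℝ (Fin N))) :
    W2 μ ν ^ 2 = ⨅ (π : Measure (EuclideanSpace ℝ (Fin N) × EuclideanSpace ℝ (Fin N)))
      (_ : IsCoupling π μ ν), ∫⁻ q, ENNReal.ofReal (‖q.1 - q.2‖ ^ 2) ∂π := by
  rw [W2, ← ENNReal.rpow_natCast, ← ENNReal.rpow_mul]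
  norm_num

-- The spatial parts of the marginals are coupled by the spatial part of `π`; on the last variable
-- Jensen's inequality bounds the cost by the squared difference of the means.
theorem W2_sq_add_ofReal_sq_integral_sub_le {m₀ m₁ : Measure (EuclideanSpace ℝ (Fin N) × ℝ)}
    [IsProbabilityMeasure m₀] (h₀ : Integrable Prod.snd m₀) (h₁ : Integrable Prod.snd m₁)
    {π : Measure ((EuclideanSpace ℝ (Fin N) × ℝ) × (EuclideanSpace ℝ (Fin N) × ℝ))}
    (hπ : IsCoupling π m₀ m₁) :
    W2 (m₀.map Prod.fst) (m₁.map Prod.fst) ^ 2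
        + ENNReal.ofReal ((∫ q, q.2 ∂m₀ - ∫ q, q.2 ∂m₁) ^ 2) ≤
      ∫⁻ q, ENNReal.ofReal (‖q.1.1 - q.2.1‖ ^ 2 + |q.1.2 - q.2.2| ^ 2) ∂π := by
  have := hπ.isProbabilityMeasure
  have hspace := hπ.map (f := Prod.fst) (g := Prod.fst) measurable_fst measurable_fst
  obtain ⟨rfl, rfl⟩ := hπ
  have hmean : ∫ q, q.2 ∂π.map Prod.fst - ∫ q, q.2 ∂π.map Prod.snd
      = ∫ q, q.1.2 - q.2.2 ∂π := by
    rw [integral_map (by fun_prop) (by fun_prop), integral_map (by fun_prop) (by fun_prop)]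
    exact (integral_sub (h₀.comp_measurable measurable_fst)
      (h₁.comp_measurable measurable_snd)).symm
  calc _ ≤ ∫⁻ q, ENNReal.ofReal (‖q.1.1 - q.2.1‖ ^ 2) ∂π
        + ∫⁻ q, ENNReal.ofReal (|q.1.2 - q.2.2| ^ 2) ∂π := by
        gcongr
        · rw [W2_sq]
          refine iInf₂_le_of_le _ hspace ?_
          rw [lintegral_map (by fun_prop) (by fun_prop)]
          rfl
        · have hjensen := enorm_integral_sq_le_lintegral (μ := π) fun q => q.1.2 - q.2.2
          simpa only [hmean, ← sq_abs (∫ _, _ ∂_), Real.enorm_eq_ofReal_abs,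
            ENNReal.ofReal_pow (abs_nonneg _)] using hjensen
    _ = _ := by
        rw [← lintegral_add_left (by fun_prop)]
        exact lintegral_congr fun q => (ENNReal.ofReal_add (by positivity) (by positivity)).symm

end Transport

section LayerSegment

variable {V : Type*} [DecidableEq V]

/-- The segment of length `√γ` centred at `a` on the line through the vertices `a` and `b`; the
continuous graph is a finite union of such segments. -/
def layerSegment (γ : ℝ) (a b : V) : Set (V → ℝ) :=
  (fun t : ℝ => vertexPoint γ a + t • (vertexPoint γ b - vertexPoint γ a)) ''
    Icc (-(1 / 2)) (1 / 2)

theorem isClosed_layerSegment (γ : ℝ) (a b : V) : IsClosed (layerSegment γ a b) :=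
  (isCompact_Icc.image (by fun_prop)).isClosed

theorem mem_layerRange_iff {G : SimpleGraph V} {γ : ℝ} {u : V} {z : V → ℝ} :
    z ∈ layerRange G γ u ↔ ∃ w, G.Adj u w ∧ z ∈ layerSegment γ u w := by
  simp only [layerRange, layerSegment, mem_ofPred_eq, mem_image, eq_comm]

theorem isClosed_layerRange [Finite V] (G : SimpleGraph V) (γ : ℝ) (u : V) :
    IsClosed (layerRange G γ u) := by
  have h : layerRange G γ u = ⋃ w ∈ {w | G.Adj u w}, layerSegment γ u w := by
    ext z
    simp [mem_layerRange_iff]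
  rw [h]
  exact (toFinite _).isClosed_biUnion fun w _ => isClosed_layerSegment γ u w

theorem lineMap_vertexPoint_mem_contGraph {G : SimpleGraph V} (γ : ℝ) {a b : V}
    (hab : G.Adj a b) {s : ℝ} (hs : s ∈ Icc (-(1 / 2) : ℝ) (3 / 2)) :
    AffineMap.lineMap (vertexPoint γ a) (vertexPoint γ b) s ∈ contGraph G γ := by
  rw [AffineMap.lineMap_apply_module']
  rcases le_total s (1 / 2) with h | h
  · exact mem_iUnion.2 ⟨a, b, hab, s, ⟨hs.1, h⟩, add_comm _ _⟩
  · refine mem_iUnion.2 ⟨b, a, hab.symm, 1 - s, ⟨by linarith [hs.2], by linarith⟩, ?_⟩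
    module

end LayerSegment

section DistPotential

variable {V : Type*} [Fintype V]

/-- The linear extension to `ℝ^V` of the graph distance to `u`, the potential against which the
length of paths in the continuous graph is measured. -/
noncomputable def distPotential (G : SimpleGraph V) (u : V) : (V → ℝ) →ₗ[ℝ] ℝ :=
  Fintype.linearCombination ℝ fun v => (G.dist u v : ℝ)

variable [DecidableEq V]

theorem distPotential_vertexPoint (G : SimpleGraph V) (γ : ℝ) (u v : V) :
    distPotential G u (vertexPoint γ v) = √γ * G.dist u v := by
  rw [distPotential, vertexPoint, Fintype.linearCombination_apply_single, smul_eq_mul]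

theorem norm_vertexPoint_sub (γ : ℝ) {a b : V} (hab : a ≠ b) :
    ‖vertexPoint γ b - vertexPoint γ a‖ = √γ := by
  refine le_antisymm ((pi_norm_le_iff_of_nonneg (Real.sqrt_nonneg γ)).2 fun i => ?_) ?_
  · rcases eq_or_ne i b with rfl | hb
    · simp [vertexPoint, hab.symm, abs_of_nonneg]
    · rcases eq_or_ne i a with rfl | ha
      · simp [vertexPoint, hab, abs_of_nonneg]
      · simp [vertexPoint, hb, ha]
  · simpa [vertexPoint, hab.symm, abs_of_nonneg] using
      norm_le_pi_norm (vertexPoint γ b - vertexPoint γ a) b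

theorem abs_distPotential_sub_le_of_adj {G : SimpleGraph V} {a b : V} (hab : G.Adj a b)
    (γ : ℝ) (u : V) :
    |distPotential G u (vertexPoint γ b - vertexPoint γ a)| ≤ √γ := by
  have hdist : |(G.dist u b : ℝ) - G.dist u a| ≤ 1 := by
    have h : G.dist u b ≤ G.dist u a + 1 ∧ G.dist u a ≤ G.dist u b + 1 := by
      have := hab.diff_dist_adj (u := u)
      lia
    rw [abs_sub_le_iff, sub_le_iff_le_add', sub_le_iff_le_add']
    exact_mod_cast h
  rw [map_sub, distPotential_vertexPoint, distPotential_vertexPoint, ← mul_sub, abs_mul,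
    abs_of_nonneg (Real.sqrt_nonneg γ)]
  exact mul_le_of_le_one_right (Real.sqrt_nonneg γ) hdist

theorem dist_distPotential_le_of_mem_layerSegment {G : SimpleGraph V} {γ : ℝ} {a b : V}
    (hab : G.Adj a b) (u : V) {z z' : V → ℝ} (hz : z ∈ layerSegment γ a b)
    (hz' : z' ∈ layerSegment γ a b) :
    dist (distPotential G u z) (distPotential G u z') ≤ dist z z' := by
  obtain ⟨s, -, rfl⟩ := hz
  obtain ⟨t, -, rfl⟩ := hz'
  simp only [dist_eq_norm]
  rw [← map_sub, add_sub_add_left_eq_sub, ← sub_smul, map_smul, norm_smul, norm_smul,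
    norm_vertexPoint_sub γ hab.ne]
  gcongr
  exact abs_distPotential_sub_le_of_adj hab γ u

theorem eventually_dist_distPotential_le (G : SimpleGraph V) (γ : ℝ) (u : V) (z : V → ℝ) :
    ∀ᶠ z' in 𝓝[contGraph G γ] z,
      dist (distPotential G u z') (distPotential G u z) ≤ dist z' z := by
  have hnear := (locallyFinite_of_finite fun e : V × V => layerSegment γ e.1 e.2).eventually_subset
    (fun e => isClosed_layerSegment γ e.1 e.2) z
  filter_upwards [hnear.filter_mono nhdsWithin_le_nhds, self_mem_nhdsWithin] with z' hz' hmem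
  obtain ⟨a, ha⟩ := mem_iUnion.1 hmem
  obtain ⟨b, hab, hz'ab⟩ := mem_layerRange_iff.1 ha
  have hzab : (a, b) ∈ {e : V × V | z ∈ layerSegment γ e.1 e.2} := hz' hz'ab
  exact dist_distPotential_le_of_mem_layerSegment hab u hz'ab hzab

theorem mem_layerRange_of_norm_sub_le {G : SimpleGraph V} {γ : ℝ} (hγ : 0 < γ) {u : V}
    {z : V → ℝ} (hz : z ∈ contGraph G γ) (h : ‖z - vertexPoint γ u‖ ≤ √γ / 2) :
    z ∈ layerRange G γ u := by
  obtain ⟨a, b, hab, t, ht, rfl⟩ := mem_iUnion.1 hz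
  have hr : 0 < √γ := Real.sqrt_pos.2 hγ
  have hu := (abs_le.1 ((norm_le_pi_norm _ u).trans h)).1
  rcases eq_or_ne a u with rfl | hau
  · exact ⟨b, hab, t, ht, rfl⟩
  rcases eq_or_ne b u with rfl | hbu
  · have ht' : t = 1 / 2 := by
      simp only [vertexPoint, Pi.sub_apply, Pi.add_apply, Pi.smul_apply, Pi.single_eq_same,
        smul_eq_mul, Pi.single_eq_of_ne hau.symm] at hu
      refine le_antisymm ht.2 (le_of_mul_le_mul_right ?_ hr)
      linarith
    refine ⟨a, hab.symm, 1 / 2, by norm_num, ?_⟩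
    rw [ht']
    module
  · simp only [vertexPoint, Pi.sub_apply, Pi.add_apply, Pi.smul_apply, Pi.single_eq_same,
      smul_eq_mul, Pi.single_eq_of_ne hau.symm, Pi.single_eq_of_ne hbu.symm] at hu
    linarith

end DistPotential

section AcyclicPath

namespace AcyclicPath

variable {V : Type*} [Fintype V] [DecidableEq V] {G : SimpleGraph V} {γ : ℝ}

theorem dist_le (p : AcyclicPath G γ) {x y : ℝ} (hx : x ∈ Icc p.left p.right)
    (hy : y ∈ Icc p.left p.right) : dist (p.toFun x) (p.toFun y) ≤ |x - y| :=
  dist_le_of_hasUnitSpeedOn p.unitSpeed hx hy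

theorem sqrt_mul_dist_le_abs_sub (p : AcyclicPath G γ) {u w : V} {c c' : ℝ}
    (hc : c ∈ Icc p.left p.right) (hc' : c' ∈ Icc p.left p.right)
    (hu : (p.toFun c : V → ℝ) = vertexPoint γ u) (hw : (p.toFun c' : V → ℝ) = vertexPoint γ w) :
    √γ * G.dist u w ≤ |c - c'| := by
  wlog hcc : c ≤ c' generalizing u w c c'
  · rw [abs_sub_comm, SimpleGraph.dist_comm]
    exact this hc' hc hw hu (le_of_not_ge hcc)
  have hcont : Continuous fun t => (p.toFun t : V → ℝ) :=
    continuous_subtype_val.comp p.continuous_toFun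
  have hlip := dist_le_mul_of_eventually_dist_le (C := 1)
    (f := fun t => distPotential G u (p.toFun t)) hcc
    ((LinearMap.continuous_of_finiteDimensional _).comp hcont).continuousOn fun x hx => ?_
  · simp only [hu, hw, distPotential_vertexPoint, SimpleGraph.dist_self, Real.dist_eq] at hlip
    rw [abs_sub_comm, abs_of_nonneg (sub_nonneg.2 hcc)]
    exact (le_abs_self _).trans (by simpa using hlip)
  · have hnear := tendsto_nhdsWithin_of_tendsto_nhds_of_eventually_within _ (hcont.tendsto x)
      (.of_forall fun t => (p.toFun t).2)
      |>.eventually (eventually_dist_distPotential_le G γ u (p.toFun x))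
    filter_upwards [hnear.filter_mono nhdsWithin_le_nhds, Ioo_mem_nhdsGT hx.2] with y hy hxy
    rw [one_mul, ← abs_of_pos (sub_pos.2 hxy.1)]
    exact hy.trans (p.dist_le ⟨hc.1.trans (hx.1.trans hxy.1.le), hxy.2.le.trans hc'.2⟩
      ⟨hc.1.trans hx.1, hx.2.le.trans hc'.2⟩)

namespace ContainsLayerAt

variable {p : AcyclicPath G γ} {u : V} {c : ℝ}

theorem mem_Icc (h : p.ContainsLayerAt u c) : c ∈ Icc p.left p.right :=
  h.2 ⟨by linarith [Real.sqrt_nonneg γ], by linarith [Real.sqrt_nonneg γ]⟩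

theorem mem_layerRange (hγ : 0 < γ) (h : p.ContainsLayerAt u c) {x : ℝ}
    (hx : x ∈ Icc (c - √γ / 2) (c + √γ / 2)) : (p.toFun x : V → ℝ) ∈ layerRange G γ u := by
  refine mem_layerRange_of_norm_sub_le hγ (p.toFun x).2 ?_
  rw [← h.1, ← dist_eq_norm]
  refine (p.dist_le (h.2 hx) h.mem_Icc).trans (abs_le.2 ?_)
  constructor <;> linarith [hx.1, hx.2]

end ContainsLayerAt

end AcyclicPath

end AcyclicPath

section Polyline

variable {E : Type*} [NormedAddCommGroup E] [NormedSpace ℝ E] {P : ℕ → E} {r : ℝ} {m : ℕ}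

/-- The polygonal line with vertices `P 0, …, P (m + 1)`, at the vertex `P k` at time `k * r`, whose
first and last edges are prolonged to rays. The natural floor of a negative number is `0`, so
negative times lie on the line of the first edge. -/
noncomputable def prolongedPolyline (P : ℕ → E) (r : ℝ) (m : ℕ) (t : ℝ) : E :=
  AffineMap.lineMap (P (min ⌊t / r⌋₊ m)) (P (min ⌊t / r⌋₊ m + 1)) (t / r - (min ⌊t / r⌋₊ m : ℕ))

theorem prolongedPolyline_eq_lineMap (hr : 0 < r) {k : ℕ} (hk : k ≤ m) {t : ℝ}
    (hkt : k = 0 ∨ k * r ≤ t) (htk : k = m ∨ t ≤ (k + 1) * r) :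
    prolongedPolyline P r m t = AffineMap.lineMap (P k) (P (k + 1)) (t / r - k) := by
  rw [← le_div_iff₀ hr] at hkt
  rw [← div_le_iff₀ hr] at htk
  have hfloor : k ≤ ⌊t / r⌋₊ := by
    rcases hkt with rfl | hkt
    exacts [Nat.zero_le _, Nat.le_floor hkt]
  rw [prolongedPolyline]
  rcases htk with rfl | htk
  · rw [min_eq_right hfloor]
  rcases htk.lt_or_eq with hlt | heq
  · have hk' : ⌊t / r⌋₊ = k :=
      le_antisymm (Nat.le_of_lt_succ ((Nat.floor_lt' k.succ_ne_zero).2 (mod_cast hlt))) hfloor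
    rw [hk', min_eq_left hk]
  · have hk' : ⌊t / r⌋₊ = k + 1 := by rw [heq]; exact_mod_cast Nat.floor_natCast (k + 1)
    rcases hk.lt_or_eq with hkm | rfl
    · rw [hk', min_eq_left hkm, heq]
      simp
    · rw [hk', min_eq_right (Nat.le_succ k)]

theorem prolongedPolyline_natCast_mul (hr : 0 < r) {i : ℕ} (hi : i ≤ m + 1) :
    prolongedPolyline P r m (i * r) = P i := by
  rcases hi.lt_or_eq with hi | rfl
  · rw [prolongedPolyline_eq_lineMap hr (Nat.le_of_lt_succ hi) (.inr le_rfl)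
      (.inr (by linarith)), mul_div_cancel_right₀ _ hr.ne', sub_self, AffineMap.lineMap_apply_zero]
  · rw [prolongedPolyline_eq_lineMap hr le_rfl (.inr (by push_cast; linarith)) (.inl rfl),
      mul_div_cancel_right₀ _ hr.ne', Nat.cast_succ, add_sub_cancel_left,
      AffineMap.lineMap_apply_one]

theorem hasUnitSpeedOn_prolongedPolyline (hr : 0 < r)
    (hP : ∀ i ≤ m, dist (P i) (P (i + 1)) = r) :
    HasUnitSpeedOn (prolongedPolyline P r m) univ := by
  have hedge : ∀ k ≤ m, HasUnitSpeedOn (prolongedPolyline P r m)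
      {t | (k = 0 ∨ k * r ≤ t) ∧ (k = m ∨ t ≤ (k + 1) * r)} := by
    refine fun k hk => hasUnitSpeedOn_of_dist_eq ⟨fun x hx y hy z hz => ?_⟩ fun x hx y hy => ?_
    · exact ⟨hx.1.imp_right hz.1.trans', hy.2.imp_right hz.2.trans⟩
    · rw [prolongedPolyline_eq_lineMap hr hk hx.1 hx.2,
        prolongedPolyline_eq_lineMap hr hk hy.1 hy.2,
        dist_lineMap_lineMap, hP k hk, Real.dist_eq, sub_sub_sub_cancel_right, ← sub_div, abs_div,
        abs_of_pos hr, div_mul_cancel₀ _ hr.ne']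
  have hinit : ∀ k ≤ m, HasUnitSpeedOn (prolongedPolyline P r m)
      {t | k = m ∨ t ≤ (k + 1) * r} := by
    intro k
    induction k with
    | zero => simpa using hedge 0
    | succ k ih =>
      intro hk
      have hunion := (ih (by lia)).union (x := (k + 1) * r) (hedge (k + 1) hk)
        ⟨.inr le_rfl, fun t ht => ht.resolve_left (by lia)⟩
        ⟨⟨.inr (by push_cast; rfl), .inr (by push_cast; linarith)⟩,
          fun t ht => by simpa using ht.1⟩
      convert hunion using 1
      ext t
      have hkm : k ≠ m := by lia
      have hle : t ≤ (k + 1) * r → t ≤ (k + 1 + 1) * r := fun h => by linarith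
      have htotal := le_total t ((k + 1) * r)
      simp only [mem_ofPred_eq, mem_union, Nat.cast_succ, Nat.succ_ne_zero]
      tauto
  simpa using hinit m le_rfl

theorem apply_prolongedPolyline (hr : 0 < r) {φ : E →ₗ[ℝ] ℝ}
    (hφ : ∀ i ≤ m + 1, φ (P i) = r * i) (t : ℝ) : φ (prolongedPolyline P r m t) = t := by
  have hk : min ⌊t / r⌋₊ m ≤ m := min_le_right _ _
  rw [prolongedPolyline]
  generalize min ⌊t / r⌋₊ m = k at hk ⊢
  rw [AffineMap.lineMap_apply_module', map_add, map_smul, map_sub, hφ _ (by lia), hφ _ (by lia),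
    smul_eq_mul]
  push_cast
  field_simp
  ring

theorem exists_prolongedPolyline_eq_lineMap (hr : 0 < r) {t : ℝ}
    (ht : t ∈ Icc (-(r / 2)) ((m + 1) * r + r / 2)) :
    ∃ k ≤ m, ∃ s ∈ Icc (-(1 / 2) : ℝ) (3 / 2),
      prolongedPolyline P r m t = AffineMap.lineMap (P k) (P (k + 1)) s := by
  have ht₀ : -(1 / 2) ≤ t / r := (le_div_iff₀ hr).2 (by linarith [ht.1])
  have ht₁ : t / r ≤ m + 3 / 2 := (div_le_iff₀ hr).2 (by linarith [ht.2])
  refine ⟨_, min_le_right _ _, _, ⟨?_, ?_⟩, rfl⟩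
  · rcases le_total 0 (t / r) with h | h
    · have : ((min ⌊t / r⌋₊ m : ℕ) : ℝ) ≤ ⌊t / r⌋₊ := by exact_mod_cast min_le_left _ _
      linarith [Nat.floor_le h]
    · simpa [Nat.floor_of_nonpos h] using ht₀
  · rcases min_choice ⌊t / r⌋₊ m with h | h <;> rw [h]
    · linarith [Nat.lt_floor_add_one (t / r)]
    · linarith

end Polyline

section Geodesic

variable {V : Type*} {G : SimpleGraph V} {u w : V}

theorem exists_dist_eq_of_reachable (h : G.Reachable u w) :
    ∃ v : ℕ → V, v 0 = u ∧ v (G.dist u w) = w ∧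
      (∀ i < G.dist u w, G.Adj (v i) (v (i + 1))) ∧ ∀ i ≤ G.dist u w, G.dist u (v i) = i := by
  obtain ⟨q, hq⟩ := h.exists_walk_length_eq_dist
  refine ⟨q.getVert, by simp, by simp [← hq], fun i hi => q.adj_getVert_succ (by lia),
    fun i hi => ?_⟩
  have htake := SimpleGraph.dist_le (q.take i)
  have hdrop := SimpleGraph.dist_le (q.drop i)
  have htri := (q.take i).reachable.dist_triangle_left w
  simp only [SimpleGraph.Walk.take_length, SimpleGraph.Walk.drop_length] at htake hdrop
  lia

variable [Fintype V] [DecidableEq V] {γ : ℝ}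

theorem exists_acyclicPath_eqOn {f : ℝ → V → ℝ} {a b : ℝ} (hab : a < b)
    (hf : HasUnitSpeedOn f (Icc a b)) (hfi : InjOn f (Icc a b))
    (hfG : MapsTo f (Icc a b) (contGraph G γ)) :
    ∃ p : AcyclicPath G γ, p.left = a ∧ p.right = b ∧
      EqOn (fun t => (p.toFun t : V → ℝ)) f (Icc a b) := by
  have hfc := (lipschitzOnWith_of_hasConstantSpeedOnWith hf).continuousOn.mapsToRestrict hfG
  have heq : EqOn (fun t => (IccExtend hab.le (hfG.restrict f _ _) t).1) f (Icc a b) := fun t ht =>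
    congrArg Subtype.val (IccExtend_of_mem hab.le (hfG.restrict f _ _) ht)
  exact ⟨{
    left := a
    right := b
    left_lt_right := hab
    toFun := IccExtend hab.le (hfG.restrict f _ _)
    continuous_toFun := hfc.Icc_extend'
    injOn := fun x hx y hy hxy =>
      hfi hx hy ((heq hx).symm.trans ((congrArg Subtype.val hxy).trans (heq hy)))
    unitSpeed := fun x hx y hy =>
      (eVariationOn.congr (heq.mono inter_subset_left)).trans (hf hx hy) }, rfl, rfl, heq⟩

theorem exists_acyclicPath_of_geodesic (hγ : 0 < γ) {v : ℕ → V} {m : ℕ}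
    (hadj : ∀ i ≤ m, G.Adj (v i) (v (i + 1))) (hdist : ∀ i ≤ m + 1, G.dist u (v i) = i) :
    ∃ p : AcyclicPath G γ, ∀ i ≤ m + 1, p.ContainsLayerAt (v i) (i * √γ) := by
  have hr : 0 < √γ := Real.sqrt_pos.2 hγ
  set f := prolongedPolyline (fun i => vertexPoint γ (v i)) √γ m with hfdef
  have hspeed : HasUnitSpeedOn f univ := hasUnitSpeedOn_prolongedPolyline hr fun i hi => by
    rw [dist_comm, dist_eq_norm, norm_vertexPoint_sub γ (hadj i hi).ne]
  have hpot : Function.LeftInverse (distPotential G u) f :=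
    apply_prolongedPolyline hr fun i hi => by rw [distPotential_vertexPoint, hdist i hi]
  have hmem : MapsTo f (Icc (-(√γ / 2)) ((m + 1) * √γ + √γ / 2)) (contGraph G γ) := by
    intro t ht
    obtain ⟨k, hk, s, hs, h⟩ := exists_prolongedPolyline_eq_lineMap
      (P := fun i => vertexPoint γ (v i)) hr ht
    rw [hfdef, h]
    exact lineMap_vertexPoint_mem_contGraph γ (hadj k hk) hs
  obtain ⟨p, hleft, hright, hp⟩ := exists_acyclicPath_eqOn
    (by linarith [mul_pos (m.cast_add_one_pos (α := ℝ)) hr])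
    (hasConstantSpeedOnWith_mono hspeed ordConnected_Icc (subset_univ _))
    hpot.injective.injOn hmem
  refine ⟨p, fun i hi => ?_⟩
  have hi₀ : 0 ≤ i * √γ := by positivity
  have hi₁ : i * √γ ≤ (m + 1) * √γ := by gcongr; exact_mod_cast hi
  refine ⟨(hp ⟨by linarith, by linarith⟩).trans (prolongedPolyline_natCast_mul hr hi), ?_⟩
  rw [hleft, hright]
  exact Icc_subset_Icc (by linarith) (by linarith)

theorem exists_acyclicPath_of_ne (hγ : 0 < γ) (h : G.Reachable u w) (huw : u ≠ w) :
    ∃ p : AcyclicPath G γ, p.ContainsLayerAt u 0 ∧ p.ContainsLayerAt w (√γ * G.dist u w) := by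
  obtain ⟨v, hu, hw, hadj, hdist⟩ := exists_dist_eq_of_reachable h
  obtain ⟨m, hm⟩ := Nat.exists_eq_add_one_of_ne_zero (h.pos_dist_of_ne huw).ne'
  rw [hm] at hw hadj hdist ⊢
  obtain ⟨p, hp⟩ := exists_acyclicPath_of_geodesic hγ (fun i hi => hadj i (by lia)) hdist
  refine ⟨p, ?_, ?_⟩
  · simpa [hu] using hp 0 (Nat.zero_le _)
  · simpa [hw, mul_comm] using hp (m + 1) le_rfl

theorem exists_acyclicPath (hγ : 0 < γ) (hu : ∃ v, G.Adj u v) (huw : G.Reachable u w) :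
    ∃ p : AcyclicPath G γ, p.ContainsLayerAt u 0 ∧ p.ContainsLayerAt w (√γ * G.dist u w) := by
  rcases eq_or_ne u w with rfl | hne
  · obtain ⟨v, huv⟩ := hu
    obtain ⟨p, hp, -⟩ := exists_acyclicPath_of_ne hγ huv.reachable huv.ne
    exact ⟨p, hp, by simpa using hp⟩
  · exact exists_acyclicPath_of_ne hγ huw hne

end Geodesic

section Cylinder

variable {V : Type*} [Fintype V] [DecidableEq V] {N : ℕ} {G : SimpleGraph V} {γ : ℝ}
  {ν : Measure (EuclideanSpace ℝ (Fin N))}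

/-- The uniform distribution over the range of a layer whose vertex has the coordinate `c`. -/
noncomputable abbrev uniformLayer (γ c : ℝ) : Measure ℝ :=
  volume[|Icc (c - √γ / 2) (c + √γ / 2)]

theorem isProbabilityMeasure_uniformLayer (hγ : 0 < γ) (c : ℝ) :
    IsProbabilityMeasure (uniformLayer γ c) :=
  isProbabilityMeasure_cond_Icc (by linarith [Real.sqrt_pos.2 hγ])

theorem integrable_of_map_eq_uniformLayer {Ω : Type*} [MeasurableSpace Ω] {μ : Measure Ω}
    {f : Ω → ℝ} {c : ℝ} (hf : Measurable f) (h : μ.map f = uniformLayer γ c) :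
    Integrable f μ := by
  have hid := integrable_id_cond_Icc (c - √γ / 2) (c + √γ / 2)
  rw [← uniformLayer, ← h] at hid
  exact hid.comp_measurable hf

theorem integral_eq_of_map_eq_uniformLayer (hγ : 0 < γ) {Ω : Type*} [MeasurableSpace Ω]
    {μ : Measure Ω} {f : Ω → ℝ} {c : ℝ} (hf : Measurable f) (h : μ.map f = uniformLayer γ c) :
    ∫ x, f x ∂μ = c := by
  have hr := Real.sqrt_pos.2 hγ
  calc ∫ x, f x ∂μ = ∫ x, x ∂uniformLayer γ c := by
        rw [← h, integral_map hf.aemeasurable (by fun_prop)]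
    _ = c := by
        rw [integral_cond_Icc (by linarith)]
        ring

namespace AcyclicPath

/-- The cylinder over `ν`, in the chart of `p`, on the layer centred at the parameter `c`. -/
noncomputable def cylinder (p : AcyclicPath G γ) (ν : Measure (EuclideanSpace ℝ (Fin N)))
    (c : ℝ) : Measure (Manifold N G γ) :=
  (ν.prod (uniformLayer γ c)).map (p.chart N)

/-- The distribution `m` on the coordinate domain of the chart of `p` is the distribution `μ` on
the manifold, written in the coordinates of this chart. -/
def Represents (p : AcyclicPath G γ) (m : Measure (EuclideanSpace ℝ (Fin N) × ℝ))
    (μ : Measure (Manifold N G γ)) : Prop :=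
  (∀ᵐ q ∂m, q ∈ p.chartDomain N) ∧ m.map (p.chart N) = μ

theorem measurable_chart (p : AcyclicPath G γ) : Measurable (p.chart N) :=
  measurable_fst.prodMk (p.continuous_toFun.measurable.comp measurable_snd)

theorem measurableSet_chartDomain (p : AcyclicPath G γ) : MeasurableSet (p.chartDomain N) :=
  MeasurableSet.univ.prod measurableSet_Icc

theorem isChartCoupling_iff {p : AcyclicPath G γ} {μ₀ μ₁ : Measure (Manifold N G γ)}
    {π : Measure ((EuclideanSpace ℝ (Fin N) × ℝ) × (EuclideanSpace ℝ (Fin N) × ℝ))} :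
    IsChartCoupling p μ₀ μ₁ π ↔
      p.Represents (π.map Prod.fst) μ₀ ∧ p.Represents (π.map Prod.snd) μ₁ := by
  have hchart := p.measurable_chart (N := N)
  have hdom := p.measurableSet_chartDomain (N := N)
  have hdomain : π (p.chartDomain N ×ˢ p.chartDomain N)ᶜ = 0 ↔
      (∀ᵐ x ∂π.map Prod.fst, x ∈ p.chartDomain N) ∧
        ∀ᵐ y ∂π.map Prod.snd, y ∈ p.chartDomain N :=
    eventually_and.trans (and_congr (ae_map_iff measurable_fst.aemeasurable hdom).symm
      (ae_map_iff measurable_snd.aemeasurable hdom).symm)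
  have hcoupling : IsCoupling (π.map (Prod.map (p.chart N) (p.chart N))) μ₀ μ₁ ↔
      (π.map Prod.fst).map (p.chart N) = μ₀ ∧ (π.map Prod.snd).map (p.chart N) = μ₁ := by
    obtain ⟨hfst, hsnd⟩ := IsCoupling.map (π := π) ⟨rfl, rfl⟩ hchart hchart
    rw [IsCoupling, hfst, hsnd]
  rw [IsChartCoupling, hdomain, hcoupling, and_and_and_comm]
  rfl

theorem cylinder_eq_prod [SFinite ν] (p : AcyclicPath G γ) (c : ℝ) :
    p.cylinder ν c = ν.prod ((uniformLayer γ c).map p.toFun) := by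
  have h := Measure.map_prod_map ν (uniformLayer γ c) measurable_id
    p.continuous_toFun.measurable
  rw [Measure.map_id] at h
  exact h.symm

theorem map_fst_cylinder (hγ : 0 < γ) [SFinite ν] (p : AcyclicPath G γ) (c : ℝ) :
    (p.cylinder ν c).map Prod.fst = ν := by
  have := isProbabilityMeasure_uniformLayer hγ c
  have := Measure.isProbabilityMeasure_map (μ := uniformLayer γ c)
    p.continuous_toFun.measurable.aemeasurable
  rw [cylinder_eq_prod]
  exact Measure.fst_prod

theorem map_snd_cylinder [IsProbabilityMeasure ν] (p : AcyclicPath G γ) (c : ℝ) :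
    (p.cylinder ν c).map Prod.snd = (uniformLayer γ c).map p.toFun := by
  rw [cylinder_eq_prod]
  exact Measure.snd_prod

theorem ae_prod_uniformLayer_snd_mem (c : ℝ) : ∀ᵐ q ∂ν.prod (uniformLayer γ c),
    q.2 ∈ Icc (c - √γ / 2) (c + √γ / 2) :=
  Measure.quasiMeasurePreserving_snd.ae (ae_cond_mem measurableSet_Icc)

theorem ContainsLayerAt.represents_cylinder {p : AcyclicPath G γ} {u : V} {c : ℝ}
    (h : p.ContainsLayerAt u c) : p.Represents (ν.prod (uniformLayer γ c)) (p.cylinder ν c) := by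
  refine ⟨?_, rfl⟩
  filter_upwards [ae_prod_uniformLayer_snd_mem c] with q hq using ⟨mem_univ _, h.2 hq⟩

theorem ContainsLayerAt.layerProjection_cylinder (hγ : 0 < γ) [SFinite ν] {p : AcyclicPath G γ}
    {u : V} {c : ℝ} (h : p.ContainsLayerAt u c) : layerProjection u (p.cylinder ν c) = ν := by
  have hmeas : MeasurableSet {q : Manifold N G γ | (q.2 : V → ℝ) ∈ layerRange G γ u} :=
    (measurable_subtype_coe.comp measurable_snd) (isClosed_layerRange G γ u).measurableSet
  rw [layerProjection, Measure.restrict_eq_self_of_ae_mem, map_fst_cylinder hγ]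
  refine (ae_map_iff p.measurable_chart.aemeasurable hmeas).2 ?_
  filter_upwards [ae_prod_uniformLayer_snd_mem c] with q hq using h.mem_layerRange hγ hq

theorem Represents.exists_map_snd_eq_uniformLayer (hγ : 0 < γ) [IsProbabilityMeasure ν]
    {p p₀ : AcyclicPath G γ} {u : V} {c₀ : ℝ} (h₀ : p₀.ContainsLayerAt u c₀)
    {m : Measure (EuclideanSpace ℝ (Fin N) × ℝ)} (hm : p.Represents m (p₀.cylinder ν c₀)) :
    ∃ c ∈ Icc p.left p.right, (p.toFun c : V → ℝ) = vertexPoint γ u ∧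
      m.map Prod.snd = uniformLayer γ c := by
  have hdom : ∀ᵐ z ∂m.map Prod.snd, z ∈ Icc p.left p.right := by
    refine (ae_map_iff (by fun_prop) measurableSet_Icc).2 ?_
    filter_upwards [hm.1] with q hq using hq.2
  have hmap : (m.map Prod.snd).map p.toFun = (uniformLayer γ c₀).map p₀.toFun := by
    rw [← map_snd_cylinder (ν := ν), ← hm.2, Measure.map_map measurable_snd p.measurable_chart,
      Measure.map_map p.continuous_toFun.measurable measurable_snd]
    rfl
  obtain ⟨c, hc, hcu, hmc⟩ := exists_eq_cond_Icc_of_map_eq (half_pos (Real.sqrt_pos.2 hγ))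
    isCompact_Icc p.continuous_toFun.measurable p.unitSpeed p.injOn p₀.continuous_toFun
    (hasConstantSpeedOnWith_mono p₀.unitSpeed ordConnected_Icc h₀.2) (p₀.injOn.mono h₀.2)
    hdom hmap
  exact ⟨c, hc, by rw [hcu, h₀.1], hmc⟩

theorem Represents.map_fst_eq (hγ : 0 < γ) [SFinite ν] {p p₀ : AcyclicPath G γ} {c₀ : ℝ}
    {m : Measure (EuclideanSpace ℝ (Fin N) × ℝ)} (hm : p.Represents m (p₀.cylinder ν c₀)) :
    m.map Prod.fst = ν := by
  rw [← map_fst_cylinder hγ p₀ c₀ (ν := ν), ← hm.2,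
    Measure.map_map measurable_fst p.measurable_chart]
  rfl

end AcyclicPath

theorem isCylinderLift_iff (hγ : 0 < γ) {u : V} {μ : Measure (Manifold N G γ)} :
    IsCylinderLift u ν μ ↔
      IsGaussian ν ∧ ∃ (p : AcyclicPath G γ) (c : ℝ), p.ContainsLayerAt u c ∧
        μ = p.cylinder ν c := by
  constructor
  · rintro ⟨⟨ν', p, c, hν', hc, rfl⟩, rfl⟩
    rw [← AcyclicPath.cylinder, hc.layerProjection_cylinder hγ]
    exact ⟨hν', p, c, hc, rfl⟩
  · rintro ⟨hν, p, c, hc, rfl⟩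
    exact ⟨⟨ν, p, c, hν, hc, rfl⟩, hc.layerProjection_cylinder hγ⟩

theorem le_manifoldCost (hγ : 0 < γ) {u w : V} {ν₀ ν₁ : Measure (EuclideanSpace ℝ (Fin N))}
    {μ₀ μ₁ : Measure (Manifold N G γ)} (h₀ : IsCylinderLift u ν₀ μ₀)
    (h₁ : IsCylinderLift w ν₁ μ₁) :
    W2 ν₀ ν₁ ^ 2 + ENNReal.ofReal (γ * (G.dist u w : ℝ) ^ 2) ≤ manifoldCost μ₀ μ₁ := by
  obtain ⟨_, p₀, c₀, hc₀, rfl⟩ := (isCylinderLift_iff hγ).1 h₀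
  obtain ⟨_, p₁, c₁, hc₁, rfl⟩ := (isCylinderLift_iff hγ).1 h₁
  refine le_iInf fun p => le_iInf₂ fun π hπ => ?_
  obtain ⟨hm₀, hm₁⟩ := AcyclicPath.isChartCoupling_iff.1 hπ
  obtain ⟨c, hc, hcu, hz₀⟩ := hm₀.exists_map_snd_eq_uniformLayer hγ hc₀
  obtain ⟨c', hc', hcw, hz₁⟩ := hm₁.exists_map_snd_eq_uniformLayer hγ hc₁
  have hx₀ := hm₀.map_fst_eq hγ
  have hx₁ := hm₁.map_fst_eq hγ
  have : IsProbabilityMeasure ((π.map Prod.fst).map Prod.fst) := by rw [hx₀]; infer_instance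
  have := (π.map Prod.fst).isProbabilityMeasure_of_map Prod.fst
  have hcost := W2_sq_add_ofReal_sq_integral_sub_le (π := π)
    (integrable_of_map_eq_uniformLayer measurable_snd hz₀)
    (integrable_of_map_eq_uniformLayer measurable_snd hz₁) ⟨rfl, rfl⟩
  rw [hx₀, hx₁, integral_eq_of_map_eq_uniformLayer hγ measurable_snd hz₀,
    integral_eq_of_map_eq_uniformLayer hγ measurable_snd hz₁] at hcost
  refine le_trans ?_ hcost
  gcongr
  calc γ * (G.dist u w : ℝ) ^ 2 = (√γ * G.dist u w) ^ 2 := by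
        rw [mul_pow, Real.sq_sqrt hγ.le]
    _ ≤ |c - c'| ^ 2 := by
        gcongr
        exact p.sqrt_mul_dist_le_abs_sub hc hc' hcu hcw
    _ = (c - c') ^ 2 := sq_abs _

theorem manifoldCost_cylinder_le (hγ : 0 < γ) {u w : V}
    {ν₀ ν₁ : Measure (EuclideanSpace ℝ (Fin N))} [IsProbabilityMeasure ν₀]
    {p : AcyclicPath G γ} {c c' : ℝ} (hc : p.ContainsLayerAt u c)
    (hc' : p.ContainsLayerAt w c') :
    manifoldCost (p.cylinder ν₀ c) (p.cylinder ν₁ c') ≤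
      W2 ν₀ ν₁ ^ 2 + ENNReal.ofReal ((c' - c) ^ 2) := by
  have := isProbabilityMeasure_uniformLayer hγ c
  have hmove : (uniformLayer γ c).map (· + (c' - c)) = uniformLayer γ c' :=
    (map_isometryEquiv_cond_Icc (.addRight (c' - c)) c (√γ / 2)).trans
      (congrArg (uniformLayer γ) (add_sub_cancel c c'))
  rw [W2_sq, ENNReal.iInf_add]
  refine le_iInf fun π => ?_
  rw [ENNReal.iInf_add]
  refine le_iInf fun hπ => ?_
  have := hπ.isProbabilityMeasure
  have hplan := hπ.prod_graph (uniformLayer γ c) (measurable_add_const (c' - c))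
  rw [hmove] at hplan
  refine iInf_le_of_le p (iInf₂_le_of_le _ (AcyclicPath.isChartCoupling_iff.2
    ⟨hplan.1.symm ▸ hc.represents_cylinder, hplan.2.symm ▸ hc'.represents_cylinder⟩) ?_)
  rw [lintegral_map (by fun_prop) (by fun_prop)]
  calc _ = ∫⁻ q, ENNReal.ofReal (‖q.1.1 - q.1.2‖ ^ 2) + ENNReal.ofReal ((c' - c) ^ 2)
          ∂π.prod (uniformLayer γ c) := by
        refine lintegral_congr fun q => ?_
        rw [← ENNReal.ofReal_add (by positivity) (by positivity), sub_add_cancel_left, abs_neg,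
          sq_abs]
    _ ≤ _ := by
        rw [lintegral_add_right _ measurable_const, lintegral_const, measure_univ, mul_one,
          lintegral_prod _ (by fun_prop)]
        simp

end Cylinder

end VectorGMM

theorem theorem3_general {N : ℕ} {V : Type*} [Fintype V] [DecidableEq V] (G : SimpleGraph V)
    (γ : ℝ) (hγ : 0 < γ) (u w : V) (hu : ∃ v, G.Adj u v) (huw : G.Reachable u w)
    (ν₀ ν₁ : MeasureTheory.Measure (EuclideanSpace ℝ (Fin N)))
    [ProbabilityTheory.IsGaussian ν₀] [ProbabilityTheory.IsGaussian ν₁] :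
    VectorGMM.cylinderCost G γ u w ν₀ ν₁ =
        VectorGMM.W2 ν₀ ν₁ ^ 2 + ENNReal.ofReal (γ * (G.dist u w : ℝ) ^ 2) ∧
      ∃ μ₀ μ₁ : MeasureTheory.Measure (VectorGMM.Manifold N G γ),
        VectorGMM.IsCylinderLift u ν₀ μ₀ ∧ VectorGMM.IsCylinderLift w ν₁ μ₁ ∧
        VectorGMM.manifoldCost μ₀ μ₁ =
          VectorGMM.W2 ν₀ ν₁ ^ 2 + ENNReal.ofReal (γ * (G.dist u w : ℝ) ^ 2) := by
  obtain ⟨p, hpu, hpw⟩ := VectorGMM.exists_acyclicPath hγ hu huw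
  have h₀ : VectorGMM.IsCylinderLift u ν₀ (p.cylinder ν₀ _) :=
    (VectorGMM.isCylinderLift_iff hγ).2 ⟨inferInstance, p, _, hpu, rfl⟩
  have h₁ : VectorGMM.IsCylinderLift w ν₁ (p.cylinder ν₁ _) :=
    (VectorGMM.isCylinderLift_iff hγ).2 ⟨inferInstance, p, _, hpw, rfl⟩
  have hle := VectorGMM.manifoldCost_cylinder_le (ν₀ := ν₀) (ν₁ := ν₁) hγ hpu hpw
  rw [sub_zero, mul_pow, Real.sq_sqrt hγ.le] at hle
  refine ⟨le_antisymm ?_ ?_, _, _, h₀, h₁, hle.antisymm (VectorGMM.le_manifoldCost hγ h₀ h₁)⟩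
  · exact iInf₂_le_of_le _ h₀ (iInf₂_le_of_le _ h₁ hle)
  · exact le_iInf₂ fun _ hμ₀ => le_iInf₂ fun _ hμ₁ => VectorGMM.le_manifoldCost hγ hμ₀ hμ₁

theorem theorem3 {N : ℕ} {V : Type*} [Fintype V] [DecidableEq V] [Nontrivial V]
    (G : SimpleGraph V) (hG : G.Connected) (γ : ℝ) (hγ : 0 < γ) (u w : V)
    (ν₀ ν₁ : MeasureTheory.Measure (EuclideanSpace ℝ (Fin N)))
    [ProbabilityTheory.IsGaussian ν₀] [ProbabilityTheory.IsGaussian ν₁] :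
    VectorGMM.cylinderCost G γ u w ν₀ ν₁ =
        VectorGMM.W2 ν₀ ν₁ ^ 2 + ENNReal.ofReal (γ * (G.dist u w : ℝ) ^ 2) ∧
      ∃ μ₀ μ₁ : MeasureTheory.Measure (VectorGMM.Manifold N G γ),
        VectorGMM.IsCylinderLift u ν₀ μ₀ ∧ VectorGMM.IsCylinderLift w ν₁ μ₁ ∧
        VectorGMM.manifoldCost μ₀ μ₁ =
          VectorGMM.W2 ν₀ ν₁ ^ 2 + ENNReal.ofReal (γ * (G.dist u w : ℝ) ^ 2) :=
  theorem3_general G γ hγ u w (hG.preconnected.exists_adj_of_nontrivial u) (hG u w) ν₀ ν₁
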